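/- \textbf{Setting.} Let $\mathbb N_\infty=\mathbb N\cup\{\infty\}$. A \emph{Banach stacking} consists of real Banach spaces $(X_n,\|\cdot\|_n)_{n\in\mathbb N_\infty}$, a metric space $(\mathcal M,d)$ and maps $\xi_n:X_n\to\mathcal M$ such that, writing $x_n\twoheadrightarrow x_\infty$ (for $x_n\in X_n$, $n\in\mathbb N_\infty$) when $\xi_n(x_n)\to\xi_\infty(x_\infty)$ in $\mathcal M$ as $n\to\infty$: (i) each $\xi_n$, $n\in\mathbb N_\infty$, is $1$-Lipschitz; (ii) for every $x_\infty\in X_\infty$ there are $x_n\in X_n$, $n\in\mathbb N$, with $x_n\twoheadrightarrow x_\infty$; (iii) $x_n\twoheadrightarrow x_\infty$ and $y_n\twoheadrightarrow y_\infty$ imply $x_n+y_n\twoheadrightarrow x_\infty+y_\infty$ and $\lambda x_n\twoheadrightarrow\lambda x_\infty$ for all $\lambda\in\mathbb R$; (iv) $x_n\twoheadrightarrow x_\infty$ implies $\|x_n\|_n\to\|x_\infty\|_\infty$. An \emph{operator} on a Banach space $X$ is a set $A\subset X\times X$, with $A(x)=\{y:(x,y)\in A\}$ and $D(A)=\{x:A(x)\neq\emptyset\}$.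 It is \emph{$\omega$-accretive} ($\omega\in\mathbb R$) if $A+\omega I$ is accretive, where $B$ is accretive if $\|x-\hat x+\lambda(y-\hat y)\|\ge\|x-\hat x\|$ for all $(x,y),(\hat x,\hat y)\in B$ and $\lambda>0$. It satisfies the \emph{range condition} if there is $\delta>0$ such that $\operatorname{Range}(I+\lambda A)\supset\overline{D(A)}$ for all $\lambda\in(0,\delta)$. Its resolvent is the operator $R_\lambda(A)=(I+\lambda A)^{-1}$; where $R_\lambda(A)(z)$ is a singleton, $R_\lambda(A)z$ denotes its element. Put $\mathfrak I_\omega=(0,1/\omega)$ if $\omega>0$ and $\mathfrak I_\omega=(0,\infty)$ if $\omega\le0$. Given $T,\varepsilon>0$, an \emph{$\varepsilon$-approximate solution} on $[0,T]$ of $$u'+Au\ni0,\qquad u(0)=x\tag{$*$}$$ consists of $N\ge1$, times $0=t_0<\dots<t_N\le T$ with $t_i-t_{i-1}\le\varepsilon$ and $t_N>T-\varepsilon$, and $v_0,\dots,v_N,\theta_0=0,\theta_1,\dots,\theta_N\in X$ with $\|v_0-x\|\le\varepsilon$, $\theta_i\in\frac{v_i-v_{i-1}}{t_i-t_{i-1}}+A(v_i)$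 for $1\le i\le N$, and $\sum_{i=1}^N(t_i-t_{i-1})\|\theta_i\|\le\varepsilon$. Let $\bar v$ be the function on $[0,T]$ equal to $v_0$ at $0$, to $v_i$ on $(t_{i-1},t_i]$, and to $v_N$ on $(t_N,T]$. A function $u\in C([0,\infty);X)$ with $u(0)=x$ is a \emph{mild solution} of $(*)$ on $[0,\infty)$ if, for all $T>0$ and $\varepsilon>0$, there is an $\varepsilon$-approximate solution of $(*)$ on $[0,T]$ with $\|u(t)-\bar v(t)\|\le\varepsilon$ for all $t\in[0,T]$. Let $D(S_A)$ be the set of $x\in X$ for which $(*)$ has exactly one mild solution $u$ on $[0,\infty)$, and put $S_A(t)x=u(t)$ for $x\in D(S_A)$, $t\ge0$. \textbf{Proposition.} Let $\big((X_n,\xi_n)_{n\in\mathbb N_\infty},\mathcal M\big)$ be a Banach stacking. For each $n\in\mathbb N_\infty$ let $A_n$ be an $\omega_n$-accretive operator on $X_n$ satisfying the range condition, with $\omega_n\le\omega$ for all $n\in\mathbb N_\infty$ and some $\omega\in\mathbb R$. Suppose that for every $(x_\infty,y_\infty)\in A_\infty$ there are $(x_n,y_n)\in A_n$, $n\in\mathbb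 N$, with $x_n\twoheadrightarrow x_\infty$ and $y_n\twoheadrightarrow y_\infty$. Let $z_n\in\overline{D(A_n)}$, $n\in\mathbb N_\infty$, be such that $z_n\twoheadrightarrow z_\infty$. Then: 1. For every $\lambda\in\mathfrak I_\omega$, each set $R_\lambda(A_n)(z_n)$, $n\in\mathbb N_\infty$, has at most one element, and if $R_\lambda(A_\infty)z_\infty$ is defined (the set is non-empty), then $R_\lambda(A_n)z_n\twoheadrightarrow R_\lambda(A_\infty)z_\infty$ as $n\to\infty$ along those $n$ for which $R_\lambda(A_n)z_n$ is defined; in particular along the full sequence if it is defined for all large $n$. 2. For every $n\in\mathbb N_\infty$, $z_n\in D(S_{A_n})$. For every $t\ge0$, $S_{A_n}(t)z_n\twoheadrightarrow S_{A_\infty}(t)z_\infty$, and for every $T\in[0,\infty)$ the convergence is uniform in $t\in[0,T]$, i.e. $\sup_{t\in[0,T]}d\big(\xi_n(S_{A_n}(t)z_n),\xi_\infty(S_{A_\infty}(t)z_\infty)\big)\to0$. -/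

import Mathlib

open Set Filter Topology

universe u v

namespace NonlinOp

/-! Operators on `X` are arbitrary (multivalued) subsets of `X × X`. -/

section Operators

variable {X : Type u}

/-- The image set `A(x) = {y | (x, y) ∈ A}`. -/
def image (A : Set (X × X)) (x : X) : Set X := {y | (x, y) ∈ A}

/-- The domain `D(A) = {x | A(x) ≠ ∅}`. -/
def domain (A : Set (X × X)) : Set X := {x | (image A x).Nonempty}

/-- The range `⋃ x, A(x)`. -/
def range (A : Set (X × X)) : Set X := ⋃ x, image A x

/-- The inverse operator. -/
def inverse (A : Set (X × X)) : Set (X × X) := {p | (p.2, p.1) ∈ A}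

/-- The identity operator. -/
def identity (X : Type u) : Set (X × X) := {p | p.1 = p.2}

/-- The sum of two operators. -/
def add [Add X] (A B : Set (X × X)) : Set (X × X) :=
  {p | ∃ y z, (p.1, y) ∈ A ∧ (p.1, z) ∈ B ∧ p.2 = y + z}

/-- The scalar multiple of an operator. -/
def smul [SMul ℝ X] (c : ℝ) (A : Set (X × X)) : Set (X × X) :=
  {p | ∃ y, (p.1, y) ∈ A ∧ p.2 = c • y}

/-- The resolvent operator `R_c(A) = (I + c A)⁻¹`. -/
def resolvent [Add X] [SMul ℝ X] (c : ℝ) (A : Set (X × X)) : Set (X × X) :=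
  inverse (add (identity X) (smul c A))

open Classical in
/-- The value at `x` of an operator that is single-valued at `x`, i.e. the only element of `B(x)`.
(The value `0` off the domain is a placeholder.) -/
noncomputable def value [Zero X] (B : Set (X × X)) (x : X) : X :=
  if h : (image B x).Nonempty then h.some else 0

end Operators

section Banach

variable {X : Type u} [NormedAddCommGroup X] [NormedSpace ℝ X]

/-- The range condition: for some `δ > 0`, the range of `I + c A` contains the closure of `D(A)`
for all `c ∈ (0, δ)`. -/
def RangeCondition (A : Set (X × X)) : Prop :=
  ∃ δ : ℝ, 0 < δ ∧ ∀ c ∈ Ioo 0 δ, closure (domain A) ⊆ range (add (identity X) (smul c A))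

/-- Accretivity with respect to the norm of `X`. -/
def Accretive (A : Set (X × X)) : Prop :=
  ∀ p ∈ A, ∀ q ∈ A, ∀ c : ℝ, 0 < c → ‖p.1 - q.1‖ ≤ ‖p.1 - q.1 + c • (p.2 - q.2)‖

/-- `A` is `ω`-accretive if `A + ω I` is accretive. -/
def OmegaAccretive (ω : ℝ) (A : Set (X × X)) : Prop :=
  Accretive (add A (smul ω (identity X)))

/-- `(0, 1/ω)` if `ω > 0`, and `(0, ∞)` if `ω ≤ 0`. -/
noncomputable def stepInterval (ω : ℝ) : Set ℝ :=
  if 0 < ω then Ioo 0 (1 / ω) else Ioi 0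

/-- `t 0 < t 1 < ⋯ < t N` is an `ε`-discretization of `[0, T]` of size `N ≥ 1`.
Values `t i` with `i > N` are irrelevant. -/
structure IsDiscretization (T ε : ℝ) (N : ℕ) (t : ℕ → ℝ) : Prop where
  size_pos : 1 ≤ N
  zero : t 0 = 0
  lt_succ : ∀ i < N, t i < t (i + 1)
  step_le : ∀ i < N, t (i + 1) - t i ≤ ε
  lt_last : T - ε < t N
  last_le : t N ≤ T

/-- `(t, v, θ)` is an `ε`-approximate solution on `[0, T]` of `u' + A u ∋ 0`, `u(0) = x`.
Here `v i` and `θ i` are the values at the time `t i`, for `0 ≤ i ≤ N`. -/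
structure IsApproxSolution (A : Set (X × X)) (x : X) (T ε : ℝ) (N : ℕ) (t : ℕ → ℝ)
    (v θ : ℕ → X) : Prop where
  discr : IsDiscretization T ε N t
  error_zero : θ 0 = 0
  initial : ‖v 0 - x‖ ≤ ε
  step : ∀ i < N, θ (i + 1) ∈
    (fun y => (t (i + 1) - t i)⁻¹ • (v (i + 1) - v i) + y) '' image A (v (i + 1))
  error : ∑ i ∈ Finset.range N, (t (i + 1) - t i) * ‖θ (i + 1)‖ ≤ ε

/-- On `[0, T]`, the function `u` is within `ε` of the piecewise constant interpolation of `v`: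
the function with value `v 0` at `0`, with value `v i` on `(t (i - 1), t i]` for `1 ≤ i ≤ N`,
and with value `v N` on `(t N, T]`. -/
structure NearInterpolation (u : ℝ → X) (T ε : ℝ) (N : ℕ) (t : ℕ → ℝ) (v : ℕ → X) : Prop where
  zero : ‖u 0 - v 0‖ ≤ ε
  step : ∀ i < N, ∀ s ∈ Ioc (t i) (t (i + 1)), ‖u s - v (i + 1)‖ ≤ ε
  last : ∀ s ∈ Ioc (t N) T, ‖u s - v N‖ ≤ ε

/-- Mild solutions of `u' + A u ∋ 0`, `u(0) = x` on `[0, T]`.  Only `u` on `[0, T]` matters. -/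
structure IsMildSolutionOn (A : Set (X × X)) (x : X) (T : ℝ) (u : ℝ → X) : Prop where
  continuousOn : ContinuousOn u (Icc 0 T)
  initial : u 0 = x
  approx : ∀ ε : ℝ, 0 < ε → ∃ (N : ℕ) (t : ℕ → ℝ) (v θ : ℕ → X),
    IsApproxSolution A x T ε N t v θ ∧ NearInterpolation u T ε N t v

/-- Mild solutions of `u' + A u ∋ 0`, `u(0) = x` on `[0, ∞)`.  Only `u` on `[0, ∞)` matters. -/
def IsMildSolution (A : Set (X × X)) (x : X) (u : ℝ → X) : Prop :=
  ContinuousOn u (Ici 0) ∧ ∀ T : ℝ, 0 < T → IsMildSolutionOn A x T u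

/-- The domain `D(S_A)` of the semigroup: the initial values `x` for which there is exactly one
mild solution on `[0, ∞)`. -/
def semigroupDomain (A : Set (X × X)) : Set X :=
  {x | ∃ u : ℝ → X, IsMildSolution A x u ∧ ∀ w, IsMildSolution A x w → EqOn w u (Ici 0)}

open Classical in
/-- The semigroup generated by `A`: for `t ≥ 0` and `x ∈ D(S_A)`, `semigroup A t x` is the value at
time `t` of the unique mild solution starting from `x`. (The value `0` for `x ∉ D(S_A)` is a
placeholder.) -/
noncomputable def semigroup (A : Set (X × X)) (t : ℝ) (x : X) : X :=
  if h : x ∈ semigroupDomain A then h.choose t else 0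

end Banach

section Stacking

variable {X : ℕ∞ → Type u} {M : Type v} [MetricSpace M]

/-- Convergence of `x n ∈ X n` to `a ∈ X ∞`, i.e. of `ξ n (x n)` to `ξ ∞ a` in `M`. -/
def StackTendsto (ξ : ∀ n, X n → M) (x : ∀ n : ℕ, X n) (a : X ⊤) : Prop :=
  Tendsto (fun n : ℕ => ξ n (x n)) atTop (𝓝 (ξ ⊤ a))

/-- The Banach spaces `X n`, `n ∈ ℕ ∪ {∞}`, with the maps `ξ n : X n → M`, form a
Banach stacking. -/
structure IsBanachStacking [∀ n, NormedAddCommGroup (X n)] [∀ n, NormedSpace ℝ (X n)]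
    [∀ n, CompleteSpace (X n)] (ξ : ∀ n, X n → M) : Prop where
  lipschitz : ∀ n, LipschitzWith 1 (ξ n)
  exists_seq : ∀ a : X ⊤, ∃ x : ∀ n : ℕ, X n, StackTendsto ξ x a
  add : ∀ (x y : ∀ n : ℕ, X n) (a b : X ⊤), StackTendsto ξ x a → StackTendsto ξ y b →
    StackTendsto ξ (fun n => x n + y n) (a + b)
  smul : ∀ (c : ℝ) (x : ∀ n : ℕ, X n) (a : X ⊤), StackTendsto ξ x a →
    StackTendsto ξ (fun n => c • x n) (c • a)
  norm : ∀ (x : ∀ n : ℕ, X n) (a : X ⊤), StackTendsto ξ x a →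
    Tendsto (fun n : ℕ => ‖x n‖) atTop (𝓝 ‖a‖)

end Stacking

end NonlinOp

/-! Resolvents: if z∞ = x + c y with `(x, y) ∈ A ⊤`, then the approximating pairs (x_n, y_n) ∈ A_n
make x_n the resolvent of A_n at x_n + c y_n. The distance from this point to z_n tends to 0, and
the resolvents share the Lipschitz constant 1/(1 - cω).

Semigroups: the core is a Kobayashi-type estimate. By accretivity the distances ‖v_i - w_j‖ between
two approximate solutions satisfy a discrete two-time inequality (`QuasiAccretive.two_step`), and an
explicit barrier built from (t_i - s_j)² dominates them (`double_seq_le`, `QuasiAccretive.compare`).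
The resulting modulus (`exists_compare`) depends on the space, the operator and z only through a
bound on ‖y‖ for one pair (x, y) ∈ A with x close to z.

The range condition provides implicit Euler schemes. With the modulus, completeness turns them into
a mild solution, which is unique and stays close to every fine approximate solution. The pairs (x_n,
y_n) approximating one (x∞, y∞) have ‖y_n‖ eventually bounded, so a single modulus serves all large
n. Since an approximate solution for `A ⊤` involves only finitely many elements of `A ⊤`, it lifts
to all large n on the same time grid (`exists_lift_approx`). Comparing each semigroup with its
scheme, and the schemes at finitely many nodes, gives uniform convergence. -/

namespace NonlinOp

/-! ### Barrier for the discrete two-time inequality -/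

section RealEstimates

/-- With x = ω(b - a) this is (1 - x) e^{2x} ≥ (1 - x)(1 + 2x) ≥ 1, valid for 0 ≤ x ≤ 1/2. It is why
the exponents carry the factor 2. -/
theorem exp_le_one_sub_mul_exp {ω a b : ℝ} (hω : 0 ≤ ω) (hab : 0 ≤ b - a)
    (h : ω * (b - a) ≤ 1 / 2) :
    Real.exp (2 * ω * a) ≤ (1 - ω * (b - a)) * Real.exp (2 * ω * b) := by
  have h0 : 0 ≤ ω * (b - a) := mul_nonneg hω hab
  have h1 : 1 + 2 * (ω * (b - a)) ≤ Real.exp (2 * (ω * (b - a))) := by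
    linarith [Real.add_one_le_exp (2 * (ω * (b - a)))]
  have h2 : Real.exp (2 * ω * b) = Real.exp (2 * ω * a) * Real.exp (2 * (ω * (b - a))) := by
    rw [← Real.exp_add]; ring_nf
  rw [h2]
  have h3 : 1 ≤ (1 - ω * (b - a)) * Real.exp (2 * (ω * (b - a))) := by
    nlinarith
  nlinarith [Real.exp_pos (2 * ω * a)]

/-- Induction step for the barrier: `B` solves the recursion with ω = 0 exactly, and the exponential
weights `E`, `F` absorb the term -ωγδ. The weights gain EF·ωγδ(B₁ + B₂), while EF·ωγδB is needed,
hence the hypothesis `B ≤ B₁ + B₂`. -/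
theorem le_mul_of_two_step {ω γ δ E₀ E F₀ F B B₁ B₂ a a₁ a₂ f : ℝ} (hω : 0 ≤ ω)
    (hγ : 0 < γ) (hδ : 0 < δ) (hγω : ω * γ ≤ 1 / 2) (hE : E₀ ≤ (1 - ω * γ) * E)
    (hF : F₀ ≤ (1 - ω * δ) * F) (hE1 : 1 ≤ E) (hF1 : 1 ≤ F) (hB₁ : 0 ≤ B₁) (hB₂ : 0 ≤ B₂)
    (hf : 0 ≤ f) (hB : (γ + δ) * B = γ * B₁ + δ * B₂ + γ * δ * f) (hBle : B ≤ B₁ + B₂)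
    (ha₁ : a₁ ≤ E * F₀ * B₁) (ha₂ : a₂ ≤ E₀ * F * B₂)
    (ha : (γ + δ - ω * γ * δ) * a ≤ γ * a₁ + δ * a₂ + γ * δ * f) : a ≤ E * F * B := by
  have hc : 0 < γ + δ - ω * γ * δ := by nlinarith
  have hEF : 1 ≤ E * F := one_le_mul_of_one_le_of_one_le hE1 hF1
  have h1 : a₁ ≤ E * F * ((1 - ω * δ) * B₁) := by
    refine ha₁.trans ?_
    have := mul_le_mul_of_nonneg_left hF (by positivity : 0 ≤ E * B₁)
    linarith
  have h2 : a₂ ≤ E * F * ((1 - ω * γ) * B₂) := by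
    refine ha₂.trans ?_
    have := mul_le_mul_of_nonneg_left hE (by positivity : 0 ≤ F * B₂)
    linarith
  have h3 : γ * δ * f ≤ E * F * (γ * δ * f) := le_mul_of_one_le_left (by positivity) hEF
  have h4 : E * F * (ω * γ * δ * B) ≤ E * F * (ω * γ * δ * (B₁ + B₂)) := by gcongr
  refine le_of_mul_le_mul_left (ha.trans ?_) hc
  have h5 := mul_le_mul_of_nonneg_left h1 hγ.le
  have h6 := mul_le_mul_of_nonneg_left h2 hδ.le
  have h7 : E * F * ((γ + δ) * B) = E * F * (γ * B₁ + δ * B₂ + γ * δ * f) := by rw [hB]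
  linarith

/-- A comparison principle for double sequences (discrete supersolutions of the
two-time evolution inequality). -/
theorem double_seq_le {ω K m : ℝ} (hω : 0 ≤ ω) (hK : 0 ≤ K) (hm : 0 ≤ m) {N M : ℕ}
    {t s f g : ℕ → ℝ} {a : ℕ → ℕ → ℝ} (ht0 : t 0 = 0) (hs0 : s 0 = 0)
    (ht : ∀ i < N, 0 < t (i + 1) - t i) (hs : ∀ j < M, 0 < s (j + 1) - s j)
    (htω : ∀ i < N, ω * (t (i + 1) - t i) ≤ 1 / 2) (hsω : ∀ j < M, ω * (s (j + 1) - s j) ≤ 1 / 2)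
    (htn : ∀ i ≤ N, 0 ≤ t i) (hsn : ∀ j ≤ M, 0 ≤ s j)
    (hf : ∀ i, 0 ≤ f i) (hg : ∀ j, 0 ≤ g j)
    (hrec : ∀ i < N, ∀ j < M,
      ((t (i + 1) - t i) + (s (j + 1) - s j) - ω * (t (i + 1) - t i) * (s (j + 1) - s j))
        * a (i + 1) (j + 1) ≤
      (t (i + 1) - t i) * a (i + 1) j + (s (j + 1) - s j) * a i (j + 1)
        + (t (i + 1) - t i) * (s (j + 1) - s j) * (f i + g j))
    (hl : ∀ j ≤ M, a 0 j ≤ Real.exp (2 * ω * s j) * (K + m * (s j ^ 2 +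
      ∑ k ∈ Finset.range j, (s (k + 1) - s k) ^ 2) +
      ∑ k ∈ Finset.range j, (s (k + 1) - s k) * g k))
    (hr : ∀ i ≤ N, a i 0 ≤ Real.exp (2 * ω * t i) * (K + m * (t i ^ 2 +
      ∑ k ∈ Finset.range i, (t (k + 1) - t k) ^ 2) +
      ∑ k ∈ Finset.range i, (t (k + 1) - t k) * f k)) :
    ∀ i ≤ N, ∀ j ≤ M, a i j ≤ Real.exp (2 * ω * t i) * Real.exp (2 * ω * s j) *
      (K + m * ((t i - s j) ^ 2 + ∑ k ∈ Finset.range i, (t (k + 1) - t k) ^ 2 +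
        ∑ k ∈ Finset.range j, (s (k + 1) - s k) ^ 2) +
        ∑ k ∈ Finset.range i, (t (k + 1) - t k) * f k +
        ∑ k ∈ Finset.range j, (s (k + 1) - s k) * g k) := by
  intro i
  induction i with
  | zero => intro _ j hj; simpa [ht0] using hl j hj
  | succ i ihi =>
    intro hi j
    induction j with
    | zero => intro _; simpa [hs0] using hr (i + 1) hi
    | succ j ihj =>
      intro hj
      have hP : 0 ≤ ∑ k ∈ Finset.range i, (t (k + 1) - t k) ^ 2 :=
        Finset.sum_nonneg fun _ _ => sq_nonneg _
      have hP' : 0 ≤ ∑ k ∈ Finset.range j, (s (k + 1) - s k) ^ 2 :=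
        Finset.sum_nonneg fun _ _ => sq_nonneg _
      have hS : 0 ≤ ∑ k ∈ Finset.range i, (t (k + 1) - t k) * f k :=
        Finset.sum_nonneg fun k hk =>
          mul_nonneg (ht k (by have := Finset.mem_range.1 hk; omega)).le (hf k)
      have hS' : 0 ≤ ∑ k ∈ Finset.range j, (s (k + 1) - s k) * g k :=
        Finset.sum_nonneg fun k hk =>
          mul_nonneg (hs k (by have := Finset.mem_range.1 hk; omega)).le (hg k)
      have hγ := ht i (by omega)
      have hδ := hs j (by omega)
      have hfi := mul_nonneg hγ.le (hf i)
      have hgj := mul_nonneg hδ.le (hg j)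
      have h1 := ihj (by omega)
      have h2 := ihi (by omega) (j + 1) hj
      refine le_mul_of_two_step hω hγ hδ (htω i (by omega))
        (exp_le_one_sub_mul_exp hω hγ.le (htω i (by omega)))
        (exp_le_one_sub_mul_exp hω hδ.le (hsω j (by omega)))
        (Real.one_le_exp (mul_nonneg (by positivity) (htn _ hi)))
        (Real.one_le_exp (mul_nonneg (by positivity) (hsn _ hj))) ?_ ?_
        (add_nonneg (hf i) (hg j)) ?_ ?_ h1 h2 (hrec i (by omega) j (by omega))
      · rw [Finset.sum_range_succ, Finset.sum_range_succ (fun k => (t (k + 1) - t k) * f k)]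
        positivity
      · rw [Finset.sum_range_succ, Finset.sum_range_succ (fun k => (s (k + 1) - s k) * g k)]
        positivity
      -- With r the difference of the two new times, γ(r + δ)² + δ(r - γ)² = (γ + δ)r² + γδ(γ + δ).
      -- The sums of squared steps are in the barrier to cancel the last term.
      · simp only [Finset.sum_range_succ]
        ring
      · simp only [Finset.sum_range_succ]
        have h3 : 0 ≤ m * (((t (i + 1) - s (j + 1)) + (s (j + 1) - s j) - (t (i + 1) - t i)) ^ 2
            + 2 * ((s (j + 1) - s j) * (t (i + 1) - t i))) := by positivity
        have h4 := mul_nonneg hm hP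
        have h5 := mul_nonneg hm hP'
        linarith

end RealEstimates

/-! ### Quasi-accretivity and inequalities for implicit steps -/

section Accretive

variable {X : Type u} [NormedAddCommGroup X] [NormedSpace ℝ X]

/-- A quantitative form of `ω`-accretivity, monotone in `ω`. -/
def QuasiAccretive (ω : ℝ) (A : Set (X × X)) : Prop :=
  ∀ p ∈ A, ∀ q ∈ A, ∀ c : ℝ, 0 < c →
    (1 - c * ω) * ‖p.1 - q.1‖ ≤ ‖p.1 - q.1 + c • (p.2 - q.2)‖

theorem OmegaAccretive.quasiAccretive {ω ω' : ℝ} {A : Set (X × X)} (hA : OmegaAccretive ω A)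
    (h : ω ≤ ω') : QuasiAccretive ω' A := by
  intro p hp q hq c hc
  rcases le_or_gt (1 - c * ω') 0 with h0 | h0
  · exact (mul_nonpos_of_nonpos_of_nonneg h0 (norm_nonneg _)).trans (norm_nonneg _)
  have h1 : 1 - c * ω' ≤ 1 - c * ω := by nlinarith
  have h2 : 0 < 1 - c * ω := h0.trans_le h1
  refine (mul_le_mul_of_nonneg_right h1 (norm_nonneg _)).trans ?_
  have hmem : ∀ r ∈ A, (r.1, r.2 + ω • r.1) ∈ add A (smul ω (identity X)) := fun r hr =>
    ⟨r.2, ω • r.1, hr, ⟨r.1, rfl, rfl⟩, rfl⟩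
  -- Adding λω(p.1 - q.1) rescales p.1 - q.1 by 1 + λω; λ = c/(1 - cω) makes this factor 1/(1 - cω),
  -- which then divides out.
  have h3 := hA _ (hmem p hp) _ (hmem q hq) (c / (1 - c * ω)) (by positivity)
  have h4 : p.1 - q.1 + (c / (1 - c * ω)) • (p.2 + ω • p.1 - (q.2 + ω • q.1)) =
      (1 - c * ω)⁻¹ • (p.1 - q.1 + c • (p.2 - q.2)) := by
    have h5 : (1 - c * ω)⁻¹ = 1 + c / (1 - c * ω) * ω := by field_simp; ring
    have h6 : (1 - c * ω)⁻¹ * c = c / (1 - c * ω) := by ring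
    rw [smul_add, smul_smul, h6, h5]
    module
  simp only at h3
  rw [h4, norm_smul, Real.norm_of_nonneg (inv_pos.2 h2).le, inv_mul_eq_div, le_div_iff₀ h2] at h3
  linarith

theorem QuasiAccretive.one_step {ω : ℝ} {A : Set (X × X)} (hA : QuasiAccretive ω A)
    {x y v v' e : X} {h : ℝ} (hxy : (x, y) ∈ A) (hh : 0 < h)
    (hv : e ∈ (fun y => h⁻¹ • (v - v') + y) '' image A v) :
    (1 - ω * h) * ‖v - x‖ ≤ ‖v' - x‖ + h * (‖e‖ + ‖y‖) := by
  obtain ⟨y', hy', rfl⟩ := hv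
  have h1 := hA (v, y') hy' (x, y) hxy h hh
  set e := h⁻¹ • (v - v') + y' with he
  have h2 : v - x + h • (y' - y) = (v' - x) + h • (e - y) := by
    have h3 : h • e = v - v' + h • y' := by rw [he, smul_add, smul_inv_smul₀ hh.ne']
    rw [smul_sub h e y, h3]
    module
  simp only at h1
  rw [h2] at h1
  have h3 := norm_add_le (v' - x) (h • (e - y))
  rw [norm_smul, Real.norm_of_nonneg hh.le] at h3
  have h4 := mul_le_mul_of_nonneg_left (norm_sub_le e y) hh.le
  rw [mul_comm ω]
  linarith

/-- For λ = γδ/(γ + δ), multiplying v - w + λ(y - y') by γ + δ combines the two difference quotients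
into γ(v - w') + δ(v' - w) + γδ(e - k), so only distances between neighbouring grid values remain.
-/
theorem QuasiAccretive.two_step {ω : ℝ} {A : Set (X × X)} (hA : QuasiAccretive ω A)
    {v v' e w w' k : X} {γ δ : ℝ} (hγ : 0 < γ) (hδ : 0 < δ)
    (hv : e ∈ (fun y => γ⁻¹ • (v - v') + y) '' image A v)
    (hw : k ∈ (fun y => δ⁻¹ • (w - w') + y) '' image A w) :
    (γ + δ - ω * γ * δ) * ‖v - w‖ ≤
      γ * ‖v - w'‖ + δ * ‖v' - w‖ + γ * δ * (‖e‖ + ‖k‖) := by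
  obtain ⟨y, hy, he⟩ := hv
  obtain ⟨y', hy', hk⟩ := hw
  simp only at he hk
  have hs : 0 < γ + δ := by positivity
  have h1 := hA (v, y) hy (w, y') hy' (γ * δ / (γ + δ)) (by positivity)
  simp only at h1
  have h2 : (γ + δ) • (v - w + (γ * δ / (γ + δ)) • (y - y')) =
      γ • (v - w') + δ • (v' - w) + (γ * δ) • (e - k) := by
    have e1 : (γ + δ) * (γ * δ / (γ + δ)) = γ * δ := by field_simp
    have e2 : (γ * δ) • e = δ • (v - v') + (γ * δ) • y := by
      rw [← he, smul_add, smul_smul]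
      congr 2
      field_simp
    have e3 : (γ * δ) • k = γ • (w - w') + (γ * δ) • y' := by
      rw [← hk, smul_add, smul_smul]
      congr 2
      field_simp
    rw [smul_add, smul_smul, e1, smul_sub (γ * δ) e k, e2, e3]
    module
  have h3 : (γ + δ) * ‖v - w + (γ * δ / (γ + δ)) • (y - y')‖ ≤
      γ * ‖v - w'‖ + δ * ‖v' - w‖ + γ * δ * (‖e‖ + ‖k‖) := by
    rw [← Real.norm_of_nonneg hs.le, ← norm_smul, Real.norm_of_nonneg hs.le, h2]
    refine (norm_add₃_le).trans ?_
    rw [norm_smul, norm_smul, norm_smul, Real.norm_of_nonneg hγ.le, Real.norm_of_nonneg hδ.le,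
      Real.norm_of_nonneg (mul_pos hγ hδ).le]
    gcongr
    exact norm_sub_le e k
  have h4 := mul_le_mul_of_nonneg_left h1 hs.le
  refine le_trans (le_of_eq ?_) (h4.trans h3)
  field_simp

end Accretive

/-! ### Time grids and piecewise constant interpolation -/

section Discretization

variable {T ε : ℝ} {N : ℕ} {t : ℕ → ℝ}

theorem IsDiscretization.sub_pos (h : IsDiscretization T ε N t) {i : ℕ} (hi : i < N) :
    0 < t (i + 1) - t i := _root_.sub_pos.2 (h.lt_succ i hi)

theorem IsDiscretization.mono (h : IsDiscretization T ε N t) :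
    ∀ j ≤ N, ∀ i ≤ j, t i ≤ t j := by
  intro j
  induction j with
  | zero => intro _ i hi; rw [Nat.le_zero.1 hi]
  | succ j ih =>
    intro hj i hi
    rcases Nat.lt_or_ge i (j + 1) with h1 | h1
    · exact (ih (by omega) i (by omega)).trans (h.lt_succ j (by omega)).le
    · rw [le_antisymm hi h1]

theorem IsDiscretization.nonneg (h : IsDiscretization T ε N t) {i : ℕ} (hi : i ≤ N) :
    0 ≤ t i := h.zero ▸ h.mono i hi 0 (Nat.zero_le _)

theorem IsDiscretization.le_end (h : IsDiscretization T ε N t) {i : ℕ} (hi : i ≤ N) :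
    t i ≤ T := (h.mono N le_rfl i hi).trans h.last_le

theorem IsDiscretization.pos (h : IsDiscretization T ε N t) : 0 < ε :=
  (h.sub_pos (i := 0) h.size_pos).trans_le (h.step_le 0 h.size_pos)

theorem IsDiscretization.sum_sq_le (h : IsDiscretization T ε N t) {i : ℕ} (hi : i ≤ N) :
    ∑ k ∈ Finset.range i, (t (k + 1) - t k) ^ 2 ≤ ε * t i := by
  calc ∑ k ∈ Finset.range i, (t (k + 1) - t k) ^ 2
      ≤ ∑ k ∈ Finset.range i, ε * (t (k + 1) - t k) := by
        refine Finset.sum_le_sum fun k hk => ?_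
        have hk' : k < N := (Finset.mem_range.1 hk).trans_le hi
        rw [sq]
        exact mul_le_mul_of_nonneg_right (h.step_le k hk') (h.sub_pos hk').le
    _ = ε * t i := by rw [← Finset.mul_sum, Finset.sum_range_sub, h.zero, sub_zero]

theorem IsDiscretization.mem_cell (h : IsDiscretization T ε N t) {τ : ℝ} (h0 : 0 < τ)
    (hτ : τ ≤ T) : (∃ i < N, τ ∈ Ioc (t i) (t (i + 1))) ∨ τ ∈ Ioc (t N) T := by
  rcases le_or_gt τ (t N) with h1 | h1
  · left
    have hex : ∃ i, τ ≤ t i := ⟨N, h1⟩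
    classical
    have hs := Nat.find_spec hex
    have hle : Nat.find hex ≤ N := Nat.find_min' hex h1
    obtain ⟨k, hk⟩ : ∃ k, Nat.find hex = k + 1 := by
      refine Nat.exists_eq_succ_of_ne_zero fun hk => ?_
      rw [hk, h.zero] at hs
      exact hs.not_gt h0
    refine ⟨k, by omega, not_le.1 (Nat.find_min hex (by omega)), hk ▸ hs⟩
  · exact Or.inr ⟨h1, hτ⟩

variable {X : Type u} [NormedAddCommGroup X]

/-- Every time is close to a node whose value is the value of the interpolation at that time. -/
theorem IsDiscretization.exists_node (h : IsDiscretization T ε N t) {τ : ℝ} (h0 : 0 ≤ τ)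
    (hτ : τ ≤ T) : ∃ i ≤ N, |t i - τ| ≤ ε ∧ ∀ (u : ℝ → X) (ρ : ℝ) (v : ℕ → X),
      NearInterpolation u T ρ N t v → ‖u τ - v i‖ ≤ ρ := by
  rcases h0.eq_or_lt with rfl | h0
  · exact ⟨0, Nat.zero_le _, by simpa [h.zero] using h.pos.le, fun u ρ v hu => hu.zero⟩
  rcases h.mem_cell h0 hτ with ⟨i, hi, hτi⟩ | hτN
  · refine ⟨i + 1, hi, ?_, fun u ρ v hu => hu.step i hi τ hτi⟩
    have := h.step_le i hi
    rw [abs_le]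
    constructor <;> linarith [hτi.1, hτi.2]
  · refine ⟨N, le_rfl, ?_, fun u ρ v hu => hu.last τ hτN⟩
    have := h.lt_last
    rw [abs_le]
    constructor <;> linarith [hτN.1, hτN.2]

theorem IsDiscretization.nearInterpolation (h : IsDiscretization T ε N t) (hT : 0 ≤ T)
    {u : ℝ → X} {ρ : ℝ}
    {v : ℕ → X} (hu : ∀ i ≤ N, ∀ τ ∈ Icc 0 T, |t i - τ| ≤ ε → ‖u τ - v i‖ ≤ ρ) :
    NearInterpolation u T ρ N t v := by
  refine ⟨hu 0 (Nat.zero_le _) 0 ⟨le_rfl, hT⟩ (by simpa [h.zero] using h.pos.le), ?_, ?_⟩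
  · intro i hi τ hτ
    have h1 := h.step_le i hi
    have h2 := h.nonneg hi.le
    have h3 := h.le_end (i := i + 1) hi
    refine hu (i + 1) hi τ ⟨by linarith [hτ.1], hτ.2.trans h3⟩ ?_
    rw [abs_le]
    constructor <;> linarith [hτ.1, hτ.2]
  · intro τ hτ
    have h1 := h.lt_last
    have h2 := h.nonneg le_rfl
    refine hu N le_rfl τ ⟨by linarith [hτ.1], hτ.2⟩ ?_
    rw [abs_le]
    constructor <;> linarith [hτ.1, hτ.2]

end Discretization

/-! ### Comparison of approximate solutions -/

section Comparison

variable {X : Type u} [NormedAddCommGroup X] [NormedSpace ℝ X] {A : Set (X × X)} {ω : ℝ}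

theorem IsApproxSolution.mul_step_le {z : X} {T ε : ℝ} {N : ℕ} {t : ℕ → ℝ} {v θ : ℕ → X}
    (h : IsApproxSolution A z T ε N t v θ) (hω : 0 ≤ ω) (hε : ω * ε ≤ 1 / 2) {i : ℕ}
    (hi : i < N) : ω * (t (i + 1) - t i) ≤ 1 / 2 :=
  (mul_le_mul_of_nonneg_left (h.discr.step_le i hi) hω).trans hε

theorem IsApproxSolution.partial_error_le {z : X} {T ε : ℝ} {N : ℕ} {t : ℕ → ℝ} {v θ : ℕ → X}
    (h : IsApproxSolution A z T ε N t v θ) {i : ℕ} (hi : i ≤ N) :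
    ∑ k ∈ Finset.range i, (t (k + 1) - t k) * ‖θ (k + 1)‖ ≤ ε := by
  refine le_trans ?_ h.error
  refine Finset.sum_le_sum_of_subset_of_nonneg (Finset.range_mono hi) fun k hk _ => ?_
  exact mul_nonneg (h.discr.sub_pos (Finset.mem_range.1 hk)).le (norm_nonneg _)

/-- Growth of an approximate solution, measured from a point of the domain. -/
theorem QuasiAccretive.growth (hA : QuasiAccretive ω A) (hω : 0 ≤ ω) {x y z : X}
    (hxy : (x, y) ∈ A) {T ε : ℝ} {N : ℕ} {t : ℕ → ℝ} {v θ : ℕ → X}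
    (h : IsApproxSolution A z T ε N t v θ) (hε : ω * ε ≤ 1 / 2) :
    ∀ i ≤ N, ‖v i - x‖ ≤ Real.exp (2 * ω * t i) * (‖v 0 - x‖ + ‖y‖ * t i +
      ∑ k ∈ Finset.range i, (t (k + 1) - t k) * ‖θ (k + 1)‖) := by
  intro i
  induction i with
  | zero => intro _; simp [h.discr.zero]
  | succ i ih =>
    intro hi
    have hh := h.discr.sub_pos hi
    have h1 := hA.one_step hxy hh (h.step i hi)
    have h2 := ih (by omega)
    have hωh := h.mul_step_le hω hε hi
    have h3 := exp_le_one_sub_mul_exp hω hh.le hωh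
    have h4 : 1 ≤ Real.exp (2 * ω * t i) :=
      Real.one_le_exp (mul_nonneg (by positivity) (h.discr.nonneg (by omega)))
    have hS : 0 ≤ ∑ k ∈ Finset.range i, (t (k + 1) - t k) * ‖θ (k + 1)‖ :=
      Finset.sum_nonneg fun k hk => mul_nonneg
        (h.discr.sub_pos (by have := Finset.mem_range.1 hk; omega)).le (norm_nonneg _)
    have ht := h.discr.nonneg (i := i) (by omega)
    rw [Finset.sum_range_succ]
    set S := ∑ k ∈ Finset.range i, (t (k + 1) - t k) * ‖θ (k + 1)‖
    set d := t (i + 1) - t i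
    have htd : t (i + 1) = t i + d := by simp [d]
    have hc : 0 < 1 - ω * d := by linarith
    refine le_of_mul_le_mul_left (h1.trans ?_) hc
    have hB : 0 ≤ ‖v 0 - x‖ + ‖y‖ * t i + S + d * (‖θ (i + 1)‖ + ‖y‖) := by positivity
    calc ‖v i - x‖ + d * (‖θ (i + 1)‖ + ‖y‖)
        ≤ Real.exp (2 * ω * t i) * (‖v 0 - x‖ + ‖y‖ * t i + S) +
          Real.exp (2 * ω * t i) * (d * (‖θ (i + 1)‖ + ‖y‖)) :=
          add_le_add h2 (le_mul_of_one_le_left (by positivity) h4)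
      _ = Real.exp (2 * ω * t i) * (‖v 0 - x‖ + ‖y‖ * t i + S + d * (‖θ (i + 1)‖ + ‖y‖)) := by
          ring
      _ ≤ (1 - ω * d) * Real.exp (2 * ω * t (i + 1)) *
          (‖v 0 - x‖ + ‖y‖ * t i + S + d * (‖θ (i + 1)‖ + ‖y‖)) :=
          mul_le_mul_of_nonneg_right h3 hB
      _ = _ := by rw [htd]; ring

theorem le_half_add_sq_div {τ κ : ℝ} (hκ : 0 < κ) : τ ≤ κ / 2 + τ ^ 2 / (2 * κ) := by
  have : κ / 2 + τ ^ 2 / (2 * κ) - τ = (τ - κ) ^ 2 / (2 * κ) := by field_simp; ring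
  have h2 : 0 ≤ (τ - κ) ^ 2 / (2 * κ) := by positivity
  linarith

/-- The barrier is quadratic in time while `growth` is linear; t ≤ κ/2 + t²/(2κ) converts one into
the other. The free parameter κ balances the constant part against the quadratic part. -/
theorem QuasiAccretive.boundary (hA : QuasiAccretive ω A) (hω : 0 ≤ ω) {x y z b : X}
    (hxy : (x, y) ∈ A) {T ε : ℝ} {N : ℕ} {t : ℕ → ℝ} {v θ : ℕ → X}
    (h : IsApproxSolution A z T ε N t v θ) (hε : ω * ε ≤ 1 / 2) {κ : ℝ} (hκ : 0 < κ) {i : ℕ}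
    (hi : i ≤ N) : ‖v i - b‖ ≤ Real.exp (2 * ω * t i) *
      ((‖v 0 - x‖ + ‖b - x‖ + ‖y‖ * κ / 2) + ‖y‖ / (2 * κ) * (t i ^ 2 +
        ∑ k ∈ Finset.range i, (t (k + 1) - t k) ^ 2) +
        ∑ k ∈ Finset.range i, (t (k + 1) - t k) * ‖θ (k + 1)‖) := by
  have h1 := hA.growth hω hxy h hε i hi
  have h4 : 1 ≤ Real.exp (2 * ω * t i) :=
    Real.one_le_exp (mul_nonneg (by positivity) (h.discr.nonneg hi))
  have h5 : ‖v i - b‖ ≤ ‖v i - x‖ + ‖b - x‖ := by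
    rw [← sub_sub_sub_cancel_right (v i) b x]; exact norm_sub_le _ _
  have h6 : ‖b - x‖ ≤ Real.exp (2 * ω * t i) * ‖b - x‖ :=
    le_mul_of_one_le_left (norm_nonneg _) h4
  have h7 := mul_le_mul_of_nonneg_left (le_half_add_sq_div (τ := t i) hκ) (norm_nonneg y)
  have h8 : 0 ≤ ‖y‖ / (2 * κ) * ∑ k ∈ Finset.range i, (t (k + 1) - t k) ^ 2 :=
    mul_nonneg (by positivity) (Finset.sum_nonneg fun _ _ => sq_nonneg _)
  have h9 : ‖y‖ * (κ / 2 + t i ^ 2 / (2 * κ)) = ‖y‖ * κ / 2 + ‖y‖ / (2 * κ) * t i ^ 2 := by ring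
  refine h5.trans ((add_le_add h1 h6).trans ?_)
  rw [← mul_add]
  refine mul_le_mul_of_nonneg_left ?_ (by positivity)
  linarith

/-- The comparison of two approximate solutions of the same equation. -/
theorem QuasiAccretive.compare (hA : QuasiAccretive ω A) (hω : 0 ≤ ω) {x y z z' : X}
    (hxy : (x, y) ∈ A) {T T' ε ε' : ℝ} {N M : ℕ} {t s : ℕ → ℝ} {v θ w η : ℕ → X}
    (h : IsApproxSolution A z T ε N t v θ) (hε : ω * ε ≤ 1 / 2)
    (h' : IsApproxSolution A z' T' ε' M s w η) (hε' : ω * ε' ≤ 1 / 2)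
    {κ : ℝ} (hκ : 0 < κ) {i j : ℕ} (hi : i ≤ N) (hj : j ≤ M) :
    ‖v i - w j‖ ≤ Real.exp (2 * ω * t i) * Real.exp (2 * ω * s j) *
      ((‖v 0 - x‖ + ‖w 0 - x‖ + ‖y‖ * κ / 2) +
        ‖y‖ / (2 * κ) * ((t i - s j) ^ 2 + ε * t i + ε' * s j) + ε + ε') := by
  have key := double_seq_le (K := ‖v 0 - x‖ + ‖w 0 - x‖ + ‖y‖ * κ / 2) (m := ‖y‖ / (2 * κ))
    (f := fun i => ‖θ (i + 1)‖) (g := fun j => ‖η (j + 1)‖) (a := fun i j => ‖v i - w j‖)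
    hω (by positivity) (by positivity) h.discr.zero h'.discr.zero
    (fun _ => h.discr.sub_pos) (fun _ => h'.discr.sub_pos)
    (fun _ => h.mul_step_le hω hε) (fun _ => h'.mul_step_le hω hε')
    (fun _ => h.discr.nonneg) (fun _ => h'.discr.nonneg)
    (fun _ => norm_nonneg _) (fun _ => norm_nonneg _)
    (fun i hi j hj => hA.two_step (h.discr.sub_pos hi) (h'.discr.sub_pos hj)
      (h.step i hi) (h'.step j hj))
    -- On the sides i = 0 and j = 0 of the index grid one solution is frozen at its starting value,
    -- which plays the role of `b`.
    (fun j hj => by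
      have := hA.boundary (b := v 0) hω hxy h' hε' hκ hj
      rw [norm_sub_rev, add_comm ‖w 0 - x‖] at this
      exact this)
    (fun i hi => hA.boundary (b := w 0) hω hxy h hε hκ hi) i hi j hj
  refine key.trans (mul_le_mul_of_nonneg_left ?_ (by positivity))
  have h1 := h.partial_error_le hi
  have h2 := h'.partial_error_le hj
  have h3 := h.discr.sum_sq_le hi
  have h4 := h'.discr.sum_sq_le hj
  have h5 : 0 ≤ ‖y‖ / (2 * κ) := by positivity
  have h6 := mul_le_mul_of_nonneg_left (add_le_add h3 h4) h5
  linarith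

end Comparison

/-! ### Moduli uniform over spaces and operators -/

section Uniform

/-- Two fine approximate solutions are close at nearby nodes, with a modulus that depends only on
`ω`, the time horizon and the size of one element of the operator near the initial value. -/
theorem exists_compare {ω T η : ℝ} (hω : 0 ≤ ω) (hT : 0 ≤ T) (hη : 0 < η) :
    ∃ ρ > 0, ∀ K : ℝ, 0 ≤ K → ∃ ε₀ > 0, ∀ (X : Type u) [NormedAddCommGroup X] [NormedSpace ℝ X]
      (A : Set (X × X)) (x y z : X), QuasiAccretive ω A → (x, y) ∈ A → ‖x - z‖ ≤ ρ → ‖y‖ ≤ K →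
      ∀ (T₁ T₂ ε₁ ε₂ : ℝ) (N M : ℕ) (t s : ℕ → ℝ) (v θ w ζ : ℕ → X),
      IsApproxSolution A z T₁ ε₁ N t v θ → IsApproxSolution A z T₂ ε₂ M s w ζ →
      ε₁ ≤ ε₀ → ε₂ ≤ ε₀ → ∀ i ≤ N, ∀ j ≤ M, t i ≤ T → s j ≤ T → |t i - s j| ≤ ε₀ →
      ‖v i - w j‖ ≤ η := by
  set C := Real.exp (2 * ω * T) * Real.exp (2 * ω * T) with hC
  have hCpos : 0 < C := by positivity
  -- The bracket in `compare` costs at most 8ρ: 2ρ for each starting value, ρ for the κ term, ρ for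
  -- the quadratic term and ρ for each error. Fixing ρ before K matters, since (x, y) is chosen near
  -- z only once ρ is known.
  obtain ⟨ρ, hρdef⟩ : ∃ ρ, ρ = η / (8 * C) := ⟨_, rfl⟩
  have hρ : 0 < ρ := by rw [hρdef]; positivity
  have hρC : C * (8 * ρ) = η := by rw [hρdef]; field_simp
  refine ⟨ρ, hρ, fun K hK => ?_⟩
  -- With κ = 2ρ/(K + 1) the quadratic coefficient is at most (K + 1)²/(4ρ); this e makes its
  -- product with e(1 + 2T) equal to ρ.
  obtain ⟨e, he⟩ : ∃ e, e = 4 * ρ ^ 2 / ((K + 1) ^ 2 * (1 + 2 * T)) := ⟨_, rfl⟩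
  have hepos : 0 < e := by rw [he]; positivity
  refine ⟨min (min 1 ρ) (min (1 / (2 * (ω + 1))) e), by positivity, ?_⟩
  intro X _ _ A x y z hA hxy hxz hy T₁ T₂ ε₁ ε₂ N M t s v θ w ζ hv hw hε₁ hε₂ i hi j hj hti hsj hts
  generalize hε₀ : min (min 1 ρ) (min (1 / (2 * (ω + 1))) e) = ε₀ at hε₁ hε₂ hts
  have hb1 : ε₀ ≤ 1 := by rw [← hε₀]; exact (min_le_left _ _).trans (min_le_left _ _)
  have hb2 : ε₀ ≤ ρ := by rw [← hε₀]; exact (min_le_left _ _).trans (min_le_right _ _)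
  have hb3 : ε₀ ≤ 1 / (2 * (ω + 1)) := by
    rw [← hε₀]; exact (min_le_right _ _).trans (min_le_left _ _)
  have hb4 : ε₀ ≤ e := by rw [← hε₀]; exact (min_le_right _ _).trans (min_le_right _ _)
  have hε₁pos := hv.discr.pos
  have hε₂pos := hw.discr.pos
  have hε₀pos : 0 < ε₀ := hε₁pos.trans_le hε₁
  have hωε : ω * ε₀ ≤ 1 / 2 := by
    rw [le_div_iff₀ (by positivity)] at hb3
    nlinarith
  have hωε₁ : ω * ε₁ ≤ 1 / 2 := (mul_le_mul_of_nonneg_left hε₁ hω).trans hωε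
  have hωε₂ : ω * ε₂ ≤ 1 / 2 := (mul_le_mul_of_nonneg_left hε₂ hω).trans hωε
  have hκ : 0 < 2 * ρ / (K + 1) := by positivity
  have key := hA.compare hω hxy hv hωε₁ hw hωε₂ hκ hi hj
  have hti0 := hv.discr.nonneg hi
  have hsj0 := hw.discr.nonneg hj
  have h0 : ∀ b : X, ‖b - z‖ ≤ ε₀ → ‖b - x‖ ≤ 2 * ρ := by
    intro b hb
    have : ‖b - x‖ ≤ ‖b - z‖ + ‖x - z‖ := by
      rw [← sub_sub_sub_cancel_right b x z]; exact norm_sub_le _ _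
    linarith
  have h1 := h0 _ (hv.initial.trans hε₁)
  have h2 := h0 _ (hw.initial.trans hε₂)
  have h3 : ‖y‖ * (2 * ρ / (K + 1)) / 2 ≤ ρ := by
    have : ‖y‖ * (2 * ρ / (K + 1)) / 2 = ρ * (‖y‖ / (K + 1)) := by ring
    rw [this]
    exact mul_le_of_le_one_right hρ.le ((div_le_one (by positivity)).2 (by linarith))
  have h4 : (t i - s j) ^ 2 + ε₁ * t i + ε₂ * s j ≤ ε₀ * (1 + 2 * T) := by
    have a1 : (t i - s j) ^ 2 ≤ ε₀ * 1 := by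
      rw [← sq_abs, sq]
      exact mul_le_mul hts (hts.trans hb1) (abs_nonneg _) hε₀pos.le
    have a2 : ε₁ * t i ≤ ε₀ * T := mul_le_mul hε₁ hti hti0 hε₀pos.le
    have a3 : ε₂ * s j ≤ ε₀ * T := mul_le_mul hε₂ hsj hsj0 hε₀pos.le
    linarith
  have h5 : ‖y‖ / (2 * (2 * ρ / (K + 1))) * ((t i - s j) ^ 2 + ε₁ * t i + ε₂ * s j) ≤ ρ := by
    calc _ ≤ (K + 1) / (2 * (2 * ρ / (K + 1))) * (e * (1 + 2 * T)) := by
          have h6 : (t i - s j) ^ 2 + ε₁ * t i + ε₂ * s j ≤ e * (1 + 2 * T) :=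
            h4.trans (mul_le_mul_of_nonneg_right hb4 (by positivity))
          have h7 : ‖y‖ ≤ K + 1 := by linarith
          gcongr
      _ = ρ := by rw [he]; field_simp; ring
  refine key.trans ?_
  rw [← hρC, hC]
  have h8 : 2 * ω * t i ≤ 2 * ω * T := mul_le_mul_of_nonneg_left hti (by positivity)
  have h9 : 2 * ω * s j ≤ 2 * ω * T := mul_le_mul_of_nonneg_left hsj (by positivity)
  refine mul_le_mul (mul_le_mul (Real.exp_le_exp.2 h8) (Real.exp_le_exp.2 h9) (Real.exp_nonneg _)
    (Real.exp_nonneg _)) ?_ (by positivity) hCpos.le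
  linarith

/-- `p` is the value at time `τ` of a limit of approximate solutions starting at `z`. -/
def IsLimitValue {X : Type u} [NormedAddCommGroup X] [NormedSpace ℝ X] (A : Set (X × X)) (z : X)
    (τ : ℝ) (p : X) : Prop :=
  ∀ ε > 0, ∃ (T : ℝ) (N : ℕ) (t : ℕ → ℝ) (v θ : ℕ → X), IsApproxSolution A z T ε N t v θ ∧
    ∃ i ≤ N, |t i - τ| ≤ ε ∧ ‖p - v i‖ ≤ ε

theorem exists_uniform_estimate {ω T η : ℝ} (hω : 0 ≤ ω) (hT : 0 ≤ T) (hη : 0 < η) :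
    ∃ ρ > 0, ∀ K : ℝ, 0 ≤ K → ∃ ε₀ > 0, ∀ (X : Type u) [NormedAddCommGroup X] [NormedSpace ℝ X]
      (A : Set (X × X)) (x y z : X), QuasiAccretive ω A → (x, y) ∈ A → ‖x - z‖ ≤ ρ → ‖y‖ ≤ K →
      ∀ (T₁ ε τ : ℝ) (p : X) (N : ℕ) (t : ℕ → ℝ) (v θ : ℕ → X),
      IsLimitValue A z τ p → IsApproxSolution A z T₁ ε N t v θ → ε ≤ ε₀ → τ ≤ T →
      ∀ i ≤ N, |t i - τ| ≤ ε₀ → ‖p - v i‖ ≤ η := by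
  -- Nodes close to τ ≤ T may lie slightly beyond T.
  obtain ⟨ρ, hρ, h⟩ := exists_compare (T := T + 1) hω (by positivity) (half_pos hη)
  refine ⟨ρ, hρ, fun K hK => ?_⟩
  obtain ⟨ε₀, hε₀, h⟩ := h K hK
  refine ⟨min (ε₀ / 2) (min 1 (η / 2)), by positivity, ?_⟩
  intro X _ _ A x y z hA hxy hxz hy T₁ ε τ p N t v θ hp hv hε hτ i hi hti
  have hpos : 0 < min (ε₀ / 2) (min 1 (η / 2)) := by positivity
  obtain ⟨T₂, M, s, w, ζ, hw, j, hj, hsj, hpw⟩ := hp _ hpos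
  generalize hε₁ : min (ε₀ / 2) (min 1 (η / 2)) = ε₁ at hε hti hw hsj hpw
  have hb1 : ε₁ ≤ ε₀ / 2 := hε₁ ▸ min_le_left _ _
  have hb2 : ε₁ ≤ 1 := hε₁ ▸ (min_le_right _ _).trans (min_le_left _ _)
  have hb3 : ε₁ ≤ η / 2 := hε₁ ▸ (min_le_right _ _).trans (min_le_right _ _)
  have hti' := abs_le.1 hti
  have hsj' := abs_le.1 hsj
  have h1 := h X A x y z hA hxy hxz hy T₁ T₂ ε ε₁ N M t s v θ w ζ hv hw (by linarith) (by linarith)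
    i hi j hj (by linarith) (by linarith) (by rw [abs_le]; constructor <;> linarith)
  have h2 : ‖p - v i‖ ≤ ‖p - w j‖ + ‖v i - w j‖ := by
    rw [← sub_sub_sub_cancel_right p (v i) (w j)]; exact norm_sub_le _ _
  linarith

end Uniform

/-! ### Existence and uniqueness of mild solutions -/

section MildSolutions

theorem exists_mem_norm_sub_lt {X : Type u} [NormedAddCommGroup X] {A : Set (X × X)} {z : X}
    (hz : z ∈ closure (domain A)) {ρ : ℝ} (hρ : 0 < ρ) :
    ∃ x y, (x, y) ∈ A ∧ ‖x - z‖ < ρ := by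
  obtain ⟨x, ⟨y, hy⟩, hx⟩ := Metric.mem_closure_iff.1 hz ρ hρ
  exact ⟨x, y, hy, by rwa [← dist_eq_norm, dist_comm]⟩

variable {X : Type u} [NormedAddCommGroup X] [NormedSpace ℝ X] {A : Set (X × X)} {ω : ℝ} {z : X}

theorem exists_estimate (hω : 0 ≤ ω) (hA : QuasiAccretive ω A) (hz : z ∈ closure (domain A))
    {T η : ℝ} (hT : 0 ≤ T) (hη : 0 < η) : ∃ ε₀ > 0,
      ∀ (T₁ ε τ : ℝ) (p : X) (N : ℕ) (t : ℕ → ℝ) (v θ : ℕ → X),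
      IsLimitValue A z τ p → IsApproxSolution A z T₁ ε N t v θ → ε ≤ ε₀ → τ ≤ T →
      ∀ i ≤ N, |t i - τ| ≤ ε₀ → ‖p - v i‖ ≤ η := by
  obtain ⟨ρ, hρ, h⟩ := exists_uniform_estimate.{u} hω hT hη
  obtain ⟨x, y, hxy, hx⟩ := exists_mem_norm_sub_lt hz hρ
  obtain ⟨ε₀, hε₀, h⟩ := h ‖y‖ (norm_nonneg y)
  exact ⟨ε₀, hε₀, h X A x y z hA hxy hx.le le_rfl⟩

theorem mem_range_add_smul {c : ℝ} {w : X} :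
    w ∈ range (add (identity X) (smul c A)) ↔ ∃ x y, (x, y) ∈ A ∧ w = x + c • y := by
  constructor
  · rintro h
    obtain ⟨x, a, b, ha, ⟨y, hy, hb⟩, hw⟩ := mem_iUnion.1 h
    change x = a at ha
    change w = a + b at hw
    change b = c • y at hb
    exact ⟨x, y, hy, by rw [hw, ← ha, hb]⟩
  · rintro ⟨x, y, hy, hw⟩
    exact mem_iUnion.2 ⟨x, x, c • y, rfl, ⟨y, hy, rfl⟩, hw⟩

theorem IsApproxSolution.mono_error {T ε ε' : ℝ} {N : ℕ} {t : ℕ → ℝ} {v θ : ℕ → X}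
    (h : IsApproxSolution A z T ε N t v θ) (hε : ε ≤ ε') : IsApproxSolution A z T ε' N t v θ :=
  ⟨⟨h.discr.size_pos, h.discr.zero, h.discr.lt_succ,
    fun i hi => (h.discr.step_le i hi).trans hε, by linarith [h.discr.lt_last], h.discr.last_le⟩,
    h.error_zero, h.initial.trans hε, h.step, h.error.trans hε⟩

/-- The implicit Euler scheme is an approximate solution. -/
theorem RangeCondition.exists_approx (hA : RangeCondition A) (hz : z ∈ closure (domain A))
    {T ε : ℝ} (hT : 0 < T) (hε : 0 < ε) :
    ∃ (N : ℕ) (t : ℕ → ℝ) (v θ : ℕ → X), IsApproxSolution A z T ε N t v θ := by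
  obtain ⟨δ, hδ, hA⟩ := hA
  obtain ⟨h, hh0, hhδ, hhε, hhT⟩ : ∃ h : ℝ, 0 < h ∧ h < δ ∧ h ≤ ε ∧ h ≤ T :=
    ⟨min (δ / 2) (min ε T), by positivity, (min_le_left _ _).trans_lt (by linarith),
      (min_le_right _ _).trans (min_le_left _ _), (min_le_right _ _).trans (min_le_right _ _)⟩
  -- The resolvent step lands in the domain, so it can be iterated on the closure with zero errors
  -- θ.
  have hstep : ∀ w : closure (domain A), ∃ x : closure (domain A), ∃ y : X,
      (x.1, y) ∈ A ∧ w.1 = x.1 + h • y := by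
    intro w
    obtain ⟨x, y, hxy, hw⟩ := mem_range_add_smul.1 (hA h ⟨hh0, hhδ⟩ w.2)
    exact ⟨⟨x, subset_closure ⟨y, hxy⟩⟩, y, hxy, hw⟩
  choose J y hJ using hstep
  refine ⟨⌊T / h⌋₊, fun i => i * h, fun i => ((J^[i]) ⟨z, hz⟩).1, fun _ => 0,
    ⟨⟨?_, by simp, ?_, ?_, ?_, ?_⟩, rfl, by simpa using hε.le, ?_, by simpa using hε.le⟩⟩
  · exact Nat.le_floor (by rw [le_div_iff₀ hh0]; simpa using hhT)
  · intro i _; push_cast; linarith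
  · intro i _; push_cast; linarith
  · have := Nat.lt_floor_add_one (T / h)
    rw [div_lt_iff₀ hh0] at this
    linarith
  · have := Nat.floor_le (div_nonneg hT.le hh0.le)
    rwa [le_div_iff₀ hh0] at this
  · intro i _
    rw [Function.iterate_succ_apply']
    obtain ⟨h1, h2⟩ := hJ ((J^[i]) ⟨z, hz⟩)
    refine ⟨_, h1, ?_⟩
    simp only
    have h3 : ((i + 1 : ℕ) : ℝ) * h - i * h = h := by push_cast; ring
    rw [h3]
    rw [h2, sub_add_cancel_left, smul_neg, inv_smul_smul₀ hh0.ne', neg_add_cancel]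

theorem IsLimitValue.of_mild {u : ℝ → X} (hu : IsMildSolution A z u) {τ : ℝ} (hτ : 0 ≤ τ) :
    IsLimitValue A z τ (u τ) := by
  intro ε hε
  obtain ⟨N, t, v, θ, hv, hn⟩ := (hu.2 (τ + 1) (by positivity)).approx ε hε
  obtain ⟨i, hi, hti, h⟩ := hv.discr.exists_node (X := X) hτ (by linarith)
  exact ⟨_, N, t, v, θ, hv, i, hi, hti, h u ε v hn⟩

/-- The estimate binds every limit value to every fine approximate solution, so a node witnessing
`p` is also close to `q`. -/
theorem IsLimitValue.unique (hω : 0 ≤ ω) (hA : QuasiAccretive ω A)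
    (hz : z ∈ closure (domain A)) {τ : ℝ} (hτ : 0 ≤ τ) {p q : X} (hp : IsLimitValue A z τ p)
    (hq : IsLimitValue A z τ q) : p = q := by
  rw [← sub_eq_zero, ← norm_le_zero_iff]
  refine le_of_forall_pos_le_add fun η hη => ?_
  obtain ⟨ε₀, hε₀, h⟩ := exists_estimate hω hA hz hτ (half_pos hη)
  obtain ⟨T, N, t, v, θ, hv, i, hi, hti, -⟩ := hp ε₀ hε₀
  have h1 := h T ε₀ τ p N t v θ hp hv le_rfl le_rfl i hi hti
  have h2 := h T ε₀ τ q N t v θ hq hv le_rfl le_rfl i hi hti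
  have h3 : ‖p - q‖ ≤ ‖p - v i‖ + ‖q - v i‖ := by
    rw [← sub_sub_sub_cancel_right p q (v i)]; exact norm_sub_le _ _
  linarith

theorem exists_isLimitValue [CompleteSpace X] (hω : 0 ≤ ω) (hA : QuasiAccretive ω A)
    (hR : RangeCondition A) (hz : z ∈ closure (domain A)) {τ : ℝ} (hτ : 0 ≤ τ) :
    ∃ p, IsLimitValue A z τ p := by
  have hex : ∀ k : ℕ, ∃ (N : ℕ) (t : ℕ → ℝ) (v θ : ℕ → X) (i : ℕ),
      IsApproxSolution A z (τ + 1) (1 / ((k : ℝ) + 1)) N t v θ ∧ i ≤ N ∧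
        |t i - τ| ≤ 1 / ((k : ℝ) + 1) := by
    intro k
    obtain ⟨N, t, v, θ, hv⟩ := hR.exists_approx hz (T := τ + 1) (by positivity)
      (Nat.one_div_pos_of_nat (α := ℝ) (n := k))
    obtain ⟨i, hi, hti, -⟩ := hv.discr.exists_node (X := X) hτ (by linarith)
    exact ⟨N, t, v, θ, i, hv, hi, hti⟩
  choose N t v θ i hv hi hti using hex
  have hsmall : ∀ ε > 0, ∃ k₀ : ℕ, ∀ k ≥ k₀, 1 / ((k : ℝ) + 1) ≤ ε := by
    intro ε hε
    obtain ⟨k₀, hk₀⟩ := exists_nat_one_div_lt hε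
    exact ⟨k₀, fun k hk => (Nat.one_div_le_one_div hk).trans hk₀.le⟩
  have hcauchy : CauchySeq fun k => v k (i k) := by
    rw [Metric.cauchySeq_iff]
    intro η hη
    obtain ⟨ρ, hρ, h⟩ := exists_compare.{u} (T := τ + 1) hω (by positivity) (half_pos hη)
    obtain ⟨x, y, hxy, hx⟩ := exists_mem_norm_sub_lt hz hρ
    obtain ⟨ε₀, hε₀, h⟩ := h ‖y‖ (norm_nonneg y)
    obtain ⟨k₀, hk₀⟩ := hsmall (ε₀ / 2) (by positivity)
    refine ⟨k₀, fun k hk l hl => ?_⟩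
    have hk' := hk₀ k hk
    have hl' := hk₀ l hl
    have h1 := abs_le.1 (hti k)
    have h2 := abs_le.1 (hti l)
    have := h X A x y z hA hxy hx.le le_rfl _ _ _ _ _ _ _ _ _ _ _ _ (hv k) (hv l)
      (by linarith) (by linarith) (i k) (hi k) (i l) (hi l) ((hv k).discr.le_end (hi k))
      ((hv l).discr.le_end (hi l)) (by rw [abs_le]; constructor <;> linarith)
    rw [dist_eq_norm]
    linarith
  obtain ⟨p, hp⟩ := cauchySeq_tendsto_of_complete hcauchy
  refine ⟨p, fun ε hε => ?_⟩
  obtain ⟨k₁, hk₁⟩ := hsmall ε hε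
  obtain ⟨k₂, hk₂⟩ := Metric.tendsto_atTop.1 hp ε hε
  have hk := hk₁ (max k₁ k₂) (le_max_left _ _)
  have hd := hk₂ (max k₁ k₂) (le_max_right _ _)
  refine ⟨τ + 1, N _, t (max k₁ k₂), v (max k₁ k₂), θ _, (hv _).mono_error hk, i _, hi _,
    (hti _).trans hk, ?_⟩
  rw [← dist_eq_norm, dist_comm]
  exact hd.le

theorem isLimitValue_zero (hR : RangeCondition A) (hz : z ∈ closure (domain A)) :
    IsLimitValue A z 0 z := by
  intro ε hε
  obtain ⟨N, t, v, θ, hv⟩ := hR.exists_approx hz one_pos hε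
  refine ⟨1, N, t, v, θ, hv, 0, Nat.zero_le _, ?_, ?_⟩
  · simpa [hv.discr.zero] using hε.le
  · rw [norm_sub_rev]; exact hv.initial

/-- One node close in time to both σ and τ is close in norm to both values, which gives continuity.
The same estimate, applied at all nodes of an Euler scheme, gives the approximation property. -/
theorem isMildSolution_of_isLimitValue (hω : 0 ≤ ω) (hA : QuasiAccretive ω A)
    (hR : RangeCondition A) (hz : z ∈ closure (domain A)) {u : ℝ → X}
    (hu : ∀ τ, 0 ≤ τ → IsLimitValue A z τ (u τ)) : IsMildSolution A z u := by
  have hcont : ContinuousOn u (Ici 0) := by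
    intro τ hτ
    have hτ0 : (0 : ℝ) ≤ τ := hτ
    rw [Metric.continuousWithinAt_iff]
    intro η hη
    obtain ⟨ε₀, hε₀, h⟩ := exists_estimate hω hA hz (T := τ + 1) (by positivity)
      (by positivity : 0 < η / 3)
    obtain ⟨T, N, t, v, θ, hv, i, hi, hti, -⟩ := hu τ hτ0 (ε₀ / 2) (by positivity)
    refine ⟨min (ε₀ / 2) 1, by positivity, fun {σ} hσ hd => ?_⟩
    rw [Real.dist_eq, lt_min_iff, abs_lt, abs_lt] at hd
    rw [abs_le] at hti
    have h1 := h T (ε₀ / 2) τ _ N t v θ (hu τ hτ0) hv (by linarith) (by linarith) i hi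
      (by rw [abs_le]; constructor <;> linarith)
    have h2 := h T (ε₀ / 2) σ _ N t v θ (hu σ hσ) hv (by linarith) (by linarith) i hi
      (by rw [abs_le]; constructor <;> linarith)
    have h3 : ‖u σ - u τ‖ ≤ ‖u σ - v i‖ + ‖u τ - v i‖ := by
      rw [← sub_sub_sub_cancel_right (u σ) (u τ) (v i)]; exact norm_sub_le _ _
    rw [dist_eq_norm]
    linarith
  refine ⟨hcont, fun T hT => ⟨hcont.mono Icc_subset_Ici_self, ?_, fun ε hε => ?_⟩⟩
  · exact (hu 0 le_rfl).unique hω hA hz le_rfl (isLimitValue_zero hR hz)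
  · obtain ⟨ε₀, hε₀, h⟩ := exists_estimate hω hA hz hT.le hε
    obtain ⟨N, t, v, θ, hv⟩ := hR.exists_approx hz hT (lt_min hε₀ hε)
    refine ⟨N, t, v, θ, hv.mono_error (min_le_right _ _),
      hv.discr.nearInterpolation hT.le fun i hi τ hτ hti => ?_⟩
    exact h T _ τ _ N t v θ (hu τ hτ.1) hv (min_le_left _ _) hτ.2 i hi
      (hti.trans (min_le_left _ _))

/-- Generation theorem: the semigroup is defined on the closure of the domain, and its values are
the limits of approximate solutions. -/
theorem mem_semigroupDomain [CompleteSpace X] (hω : 0 ≤ ω) (hA : QuasiAccretive ω A)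
    (hR : RangeCondition A) (hz : z ∈ closure (domain A)) : z ∈ semigroupDomain A := by
  have hex : ∀ τ : ℝ, ∃ p, 0 ≤ τ → IsLimitValue A z τ p := by
    intro τ
    by_cases hτ : 0 ≤ τ
    · obtain ⟨p, hp⟩ := exists_isLimitValue hω hA hR hz hτ
      exact ⟨p, fun _ => hp⟩
    · exact ⟨0, fun h => absurd h hτ⟩
  choose u hu using hex
  exact ⟨u, isMildSolution_of_isLimitValue hω hA hR hz hu, fun w hw τ hτ =>
    (IsLimitValue.of_mild hw hτ).unique hω hA hz hτ (hu τ hτ)⟩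

theorem isLimitValue_semigroup (hz : z ∈ semigroupDomain A) {τ : ℝ} (hτ : 0 ≤ τ) :
    IsLimitValue A z τ (semigroup A τ z) := by
  rw [semigroup, dif_pos hz]
  exact IsLimitValue.of_mild hz.choose_spec.1 hτ

end MildSolutions

/-! ### Resolvents of quasi-accretive operators -/

section Resolvent

variable {X : Type u}

theorem value_mem [Zero X] {B : Set (X × X)} {x : X} (h : x ∈ domain B) :
    value B x ∈ image B x := by
  have h' : (image B x).Nonempty := h
  rw [value, dif_pos h']
  exact h'.some_mem

theorem one_sub_mul_pos_of_mem_stepInterval {c ω : ℝ} (hc : c ∈ stepInterval ω) :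
    0 < c ∧ 0 < 1 - c * ω := by
  rw [stepInterval] at hc
  split_ifs at hc with h
  · have := (lt_div_iff₀ h).1 hc.2
    exact ⟨hc.1, by linarith⟩
  · have hc' : 0 < c := hc
    exact ⟨hc', by nlinarith⟩

variable [NormedAddCommGroup X] [NormedSpace ℝ X] {A : Set (X × X)} {ω c : ℝ}

theorem mem_image_resolvent {w x : X} :
    x ∈ image (resolvent c A) w ↔ ∃ y, (x, y) ∈ A ∧ w = x + c • y := by
  constructor
  · rintro ⟨a, b, ha, ⟨y, hy, hb⟩, hw⟩
    change x = a at ha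
    change w = a + b at hw
    change b = c • y at hb
    exact ⟨y, hy, by rw [hw, ← ha, hb]⟩
  · rintro ⟨y, hy, hw⟩
    exact ⟨x, c • y, rfl, ⟨y, hy, rfl⟩, hw⟩

theorem QuasiAccretive.resolvent_sub_le (hA : QuasiAccretive ω A) (hc : 0 < c) {x w x' w' : X}
    (hx : x ∈ image (resolvent c A) w) (hx' : x' ∈ image (resolvent c A) w') :
    (1 - c * ω) * ‖x - x'‖ ≤ ‖w - w'‖ := by
  obtain ⟨y, hy, rfl⟩ := mem_image_resolvent.1 hx
  obtain ⟨y', hy', rfl⟩ := mem_image_resolvent.1 hx'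
  refine (hA _ hy _ hy' c hc).trans_eq ?_
  congr 1
  simp only
  module

theorem QuasiAccretive.resolvent_subsingleton (hA : QuasiAccretive ω A)
    (hc : c ∈ stepInterval ω) (w : X) : (image (resolvent c A) w).Subsingleton := by
  intro x hx x' hx'
  obtain ⟨h0, h1⟩ := one_sub_mul_pos_of_mem_stepInterval hc
  have h2 := hA.resolvent_sub_le h0 hx hx'
  rw [sub_self, norm_zero] at h2
  have h3 : ‖x - x'‖ ≤ 0 := by
    by_contra h
    exact absurd h2 (not_le.2 (mul_pos h1 (not_le.1 h)))
  exact sub_eq_zero.1 (norm_le_zero_iff.1 h3)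

end Resolvent

/-! ### Convergence along a Banach stacking -/

section Stacking

variable {X : ℕ∞ → Type u} [∀ n, NormedAddCommGroup (X n)] [∀ n, NormedSpace ℝ (X n)]
  [∀ n, CompleteSpace (X n)] {M : Type v} [MetricSpace M] {ξ : ∀ n, X n → M}

theorem IsBanachStacking.sub (hξ : IsBanachStacking ξ) {x y : ∀ n : ℕ, X n} {a b : X ⊤}
    (hx : StackTendsto ξ x a) (hy : StackTendsto ξ y b) :
    StackTendsto ξ (fun n => x n - y n) (a - b) := by
  have h := hξ.add _ _ _ _ hx (hξ.smul (-1) _ _ hy)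
  simpa only [neg_one_smul, ← sub_eq_add_neg] using h

theorem IsBanachStacking.dist_le (hξ : IsBanachStacking ξ) (n : ℕ∞) (x y : X n) :
    dist (ξ n x) (ξ n y) ≤ ‖x - y‖ := by
  simpa [dist_eq_norm] using (hξ.lipschitz n).dist_le_mul x y

variable {A : ∀ n, Set (X n × X n)} {ω : ℝ} {z : ∀ n, X n}

theorem tendsto_resolvent (hξ : IsBanachStacking ξ) (hA : ∀ n, QuasiAccretive ω (A n))
    (hconv : ∀ p ∈ A ⊤, ∃ q : ∀ n : ℕ, X n × X n, (∀ n : ℕ, q n ∈ A n) ∧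
      StackTendsto ξ (fun n => (q n).1) p.1 ∧ StackTendsto ξ (fun n => (q n).2) p.2)
    (hz : StackTendsto ξ (fun n => z n) (z ⊤)) {c : ℝ} (hc : c ∈ stepInterval ω)
    (hdom : z ⊤ ∈ domain (resolvent c (A ⊤))) :
    Tendsto (fun n : ℕ => ξ n (value (resolvent c (A n)) (z n)))
      (atTop ⊓ 𝓟 {n : ℕ | z n ∈ domain (resolvent c (A n))})
      (𝓝 (ξ ⊤ (value (resolvent c (A ⊤)) (z ⊤)))) := by
  obtain ⟨h0, h1⟩ := one_sub_mul_pos_of_mem_stepInterval hc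
  obtain ⟨y, hy, hzy⟩ := mem_image_resolvent.1 (value_mem hdom)
  obtain ⟨q, hq, hq1, hq2⟩ := hconv _ hy
  have h2 : Tendsto (fun n : ℕ => ‖z n - ((q n).1 + c • (q n).2)‖) atTop (𝓝 0) := by
    have h := hξ.norm _ _ (hξ.sub hz (hξ.add _ _ _ _ hq1 (hξ.smul c _ _ hq2)))
    rwa [← hzy, sub_self, norm_zero] at h
  have h3 : Tendsto (fun n : ℕ => (1 - c * ω)⁻¹ * ‖z n - ((q n).1 + c • (q n).2)‖ +
      dist (ξ n (q n).1) (ξ ⊤ (value (resolvent c (A ⊤)) (z ⊤)))) atTop (𝓝 0) := by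
    simpa using (h2.const_mul (1 - c * ω)⁻¹).add (tendsto_iff_dist_tendsto_zero.1 hq1)
  rw [tendsto_iff_dist_tendsto_zero]
  refine squeeze_zero' (Eventually.of_forall fun _ => dist_nonneg) ?_
    (h3.mono_left inf_le_left)
  filter_upwards [mem_inf_of_right (mem_principal_self _)] with n hn
  refine (dist_triangle _ (ξ n (q n).1) _).trans (add_le_add_left ?_ _)
  refine (hξ.dist_le _ _ _).trans ?_
  rw [inv_mul_eq_div, le_div_iff₀ h1, mul_comm]
  exact (hA n).resolvent_sub_le h0 (value_mem hn)
    (mem_image_resolvent.2 ⟨(q n).2, hq n, rfl⟩)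

/-- Approximate solutions for the limit operator lift to approximate solutions for the
approximating operators. -/
theorem exists_lift_approx (hξ : IsBanachStacking ξ)
    (hconv : ∀ p ∈ A ⊤, ∃ q : ∀ n : ℕ, X n × X n, (∀ n : ℕ, q n ∈ A n) ∧
      StackTendsto ξ (fun n => (q n).1) p.1 ∧ StackTendsto ξ (fun n => (q n).2) p.2)
    (hz : StackTendsto ξ (fun n => z n) (z ⊤)) {T ε ε' : ℝ} (hε : ε < ε') {N : ℕ} {t : ℕ → ℝ}
    {v θ : ℕ → X ⊤} (h : IsApproxSolution (A ⊤) (z ⊤) T ε N t v θ) :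
    ∃ (v' θ' : ∀ n : ℕ, ℕ → X n), (∀ i ≤ N, StackTendsto ξ (fun n => v' n i) (v i)) ∧
      ∀ᶠ n : ℕ in atTop, IsApproxSolution (A n) (z n) T ε' N t (v' n) (θ' n) := by
  obtain ⟨a, ha⟩ := hξ.exists_seq (v 0)
  have hex : ∀ i, ∃ (y : X ⊤) (q : ∀ n : ℕ, X n × X n), i < N →
      (t (i + 1) - t i)⁻¹ • (v (i + 1) - v i) + y = θ (i + 1) ∧ (∀ n : ℕ, q n ∈ A n) ∧
      StackTendsto ξ (fun n => (q n).1) (v (i + 1)) ∧ StackTendsto ξ (fun n => (q n).2) y := by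
    intro i
    by_cases hi : i < N
    · obtain ⟨y, hy, hθ⟩ := h.step i hi
      obtain ⟨q, hq⟩ := hconv _ hy
      exact ⟨y, q, fun _ => ⟨hθ, hq⟩⟩
    · exact ⟨0, fun _ => 0, fun h => absurd h hi⟩
  choose y q hq using hex
  -- The starting value `v 0` need not lie in the domain of `A ⊤`, so index 0 uses a sequence from
  -- the stacking axiom and only later indices use pairs in the graphs. The errors `θ'` are dictated
  -- by the difference equation; they converge to `θ` because the grid is fixed.
  let v' : ∀ n : ℕ, ℕ → X n := fun n i => Nat.casesOn i (a n) fun i => (q i n).1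
  let θ' : ∀ n : ℕ, ℕ → X n := fun n i => Nat.casesOn i 0 fun i =>
    (t (i + 1) - t i)⁻¹ • (v' n (i + 1) - v' n i) + (q i n).2
  have hv' : ∀ i ≤ N, StackTendsto ξ (fun n => v' n i) (v i) := by
    rintro (_ | i) hi
    · exact ha
    · exact (hq i hi).2.2.1
  have hθ' : ∀ i < N, StackTendsto ξ (fun n => θ' n (i + 1)) (θ (i + 1)) := by
    intro i hi
    rw [← (hq i hi).1]
    exact hξ.add _ _ _ _ (hξ.smul _ _ _ (hξ.sub (hv' (i + 1) hi) (hv' i hi.le))) (hq i hi).2.2.2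
  have hinit : ∀ᶠ n : ℕ in atTop, ‖v' n 0 - z n‖ < ε' :=
    (hξ.norm _ _ (hξ.sub (hv' 0 (Nat.zero_le _)) hz)).eventually_lt_const
      (h.initial.trans_lt hε)
  have herr : ∀ᶠ n : ℕ in atTop,
      ∑ i ∈ Finset.range N, (t (i + 1) - t i) * ‖θ' n (i + 1)‖ < ε' :=
    (tendsto_finsetSum _ fun i hi => (hξ.norm _ _ (hθ' i (Finset.mem_range.1 hi))).const_mul
      (t (i + 1) - t i)).eventually_lt_const (h.error.trans_lt hε)
  refine ⟨v', θ', hv', ?_⟩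
  filter_upwards [hinit, herr] with n h1 h2
  exact ⟨⟨h.discr.size_pos, h.discr.zero, h.discr.lt_succ,
    fun i hi => (h.discr.step_le i hi).trans hε.le, by linarith [h.discr.lt_last],
    h.discr.last_le⟩, rfl, h1.le, fun i hi => ⟨(q i n).2, (hq i hi).2.1 n, rfl⟩, h2.le⟩

theorem tendstoUniformlyOn_semigroup (hξ : IsBanachStacking ξ) (hω : 0 ≤ ω)
    (hA : ∀ n, QuasiAccretive ω (A n)) (hR : ∀ n, RangeCondition (A n))
    (hconv : ∀ p ∈ A ⊤, ∃ q : ∀ n : ℕ, X n × X n, (∀ n : ℕ, q n ∈ A n) ∧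
      StackTendsto ξ (fun n => (q n).1) p.1 ∧ StackTendsto ξ (fun n => (q n).2) p.2)
    (hcl : ∀ n, z n ∈ closure (domain (A n)))
    (hz : StackTendsto ξ (fun n => z n) (z ⊤)) {T : ℝ} (hT : 0 ≤ T) :
    TendstoUniformlyOn (fun (n : ℕ) (t : ℝ) => ξ n (semigroup (A n) t (z n)))
      (fun t => ξ ⊤ (semigroup (A ⊤) t (z ⊤))) atTop (Icc 0 T) := by
  have hlim : ∀ (n : ℕ∞) (τ : ℝ), 0 ≤ τ → IsLimitValue (A n) (z n) τ (semigroup (A n) τ (z n)) :=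
    fun n τ hτ => isLimitValue_semigroup (mem_semigroupDomain hω (hA n) (hR n) (hcl n)) hτ
  rw [Metric.tendstoUniformlyOn_iff]
  intro η hη
  obtain ⟨ρ, hρ, hest⟩ := exists_uniform_estimate.{u} hω hT (by positivity : 0 < η / 3)
  obtain ⟨x, y, hxy, hx⟩ := exists_mem_norm_sub_lt (hcl ⊤) hρ
  obtain ⟨ε₀, hε₀, hest⟩ := hest (‖y‖ + 1) (by positivity)
  obtain ⟨q, hq, hq1, hq2⟩ := hconv _ hxy
  have hqx : ∀ᶠ n : ℕ in atTop, ‖(q n).1 - z n‖ < ρ :=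
    (hξ.norm _ _ (hξ.sub hq1 hz)).eventually_lt_const hx
  have hqy : ∀ᶠ n : ℕ in atTop, ‖(q n).2‖ < ‖y‖ + 1 :=
    (hξ.norm _ _ hq2).eventually_lt_const (lt_add_one _)
  -- Starting from ε₀/2 leaves room for the lifted scheme to have error ε₀. The horizon T + 1 is
  -- positive even when T = 0.
  obtain ⟨N, t, v, θ, hv⟩ := (hR ⊤).exists_approx (hcl ⊤) (T := T + 1) (by positivity)
    (half_pos hε₀)
  obtain ⟨v', θ', hv', happ⟩ := exists_lift_approx hξ hconv hz (half_lt_self hε₀) hv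
  have hnodes : ∀ᶠ n : ℕ in atTop, ∀ i ∈ Finset.range (N + 1),
      dist (ξ n (v' n i)) (ξ ⊤ (v i)) < η / 3 := by
    rw [Filter.eventually_all_finset]
    intro i hi
    exact (hv' i (Nat.lt_succ_iff.1 (Finset.mem_range.1 hi))).eventually
      (Metric.ball_mem_nhds _ (by positivity))
  filter_upwards [hqx, hqy, happ, hnodes] with n h1 h2 h3 h4 τ hτ
  obtain ⟨i, hi, hti, -⟩ := hv.discr.exists_node (X := X ⊤) hτ.1 (by linarith [hτ.2])
  have hti' : |t i - τ| ≤ ε₀ := by linarith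
  have e1 := hest (X ⊤) (A ⊤) x y (z ⊤) (hA ⊤) hxy hx.le (by linarith) _ _ τ _ N t v θ
    (hlim ⊤ τ hτ.1) hv (by linarith) hτ.2 i hi hti'
  have e2 := hest (X n) (A n) _ _ (z n) (hA n) (hq n) h1.le h2.le _ _ τ _ N t (v' n) (θ' n)
    (hlim n τ hτ.1) h3 le_rfl hτ.2 i hi hti'
  have e3 := h4 i (Finset.mem_range.2 (Nat.lt_succ_of_le hi))
  have e4 := hξ.dist_le ⊤ (semigroup (A ⊤) τ (z ⊤)) (v i)
  have e5 := hξ.dist_le n (semigroup (A n) τ (z n)) (v' n i)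
  have e6 := dist_triangle4 (ξ ⊤ (semigroup (A ⊤) τ (z ⊤))) (ξ ⊤ (v i)) (ξ n (v' n i))
    (ξ n (semigroup (A n) τ (z n)))
  rw [dist_comm (ξ ⊤ (v i)), dist_comm (ξ n (v' n i)) (ξ n (semigroup (A n) τ (z n)))] at e6
  linarith

end Stacking

end NonlinOp

theorem mainTheorem5
    {X : ℕ∞ → Type u} [∀ n, NormedAddCommGroup (X n)] [∀ n, NormedSpace ℝ (X n)]
    [∀ n, CompleteSpace (X n)] {M : Type v} [MetricSpace M] (ξ : ∀ n, X n → M)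
    (hξ : NonlinOp.IsBanachStacking ξ)
    (A : ∀ n, Set (X n × X n)) (ωs : ℕ∞ → ℝ) (ω : ℝ) (hω : ∀ n, ωs n ≤ ω)
    (hacc : ∀ n, NonlinOp.OmegaAccretive (ωs n) (A n))
    (hrange : ∀ n, NonlinOp.RangeCondition (A n))
    (hconv : ∀ p ∈ A ⊤, ∃ q : ∀ n : ℕ, X n × X n, (∀ n : ℕ, q n ∈ A n) ∧
      NonlinOp.StackTendsto ξ (fun n => (q n).1) p.1 ∧
      NonlinOp.StackTendsto ξ (fun n => (q n).2) p.2)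
    (z : ∀ n, X n) (hz : ∀ n, z n ∈ closure (NonlinOp.domain (A n)))
    (hzconv : NonlinOp.StackTendsto ξ (fun n => z n) (z ⊤)) :
    -- the resolvents are single-valued and converge, wherever they are defined
    (∀ c ∈ NonlinOp.stepInterval ω,
      (∀ n, (NonlinOp.image (NonlinOp.resolvent c (A n)) (z n)).Subsingleton) ∧
      (z ⊤ ∈ NonlinOp.domain (NonlinOp.resolvent c (A ⊤)) →
        Tendsto (fun n : ℕ => ξ n (NonlinOp.value (NonlinOp.resolvent c (A n)) (z n)))
          (atTop ⊓ 𝓟 {n : ℕ | z n ∈ NonlinOp.domain (NonlinOp.resolvent c (A n))})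
          (𝓝 (ξ ⊤ (NonlinOp.value (NonlinOp.resolvent c (A ⊤)) (z ⊤)))))) ∧
    -- the semigroups are defined at the given points, and converge
    (∀ n, z n ∈ NonlinOp.semigroupDomain (A n)) ∧
    (∀ t : ℝ, 0 ≤ t →
      NonlinOp.StackTendsto ξ (fun n => NonlinOp.semigroup (A n) t (z n))
        (NonlinOp.semigroup (A ⊤) t (z ⊤))) ∧
    (∀ T : ℝ, 0 ≤ T →
      TendstoUniformlyOn (fun (n : ℕ) (t : ℝ) => ξ n (NonlinOp.semigroup (A n) t (z n)))
        (fun t => ξ ⊤ (NonlinOp.semigroup (A ⊤) t (z ⊤))) atTop (Icc 0 T)) := by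
  have hA : ∀ n, NonlinOp.QuasiAccretive ω (A n) := fun n => (hacc n).quasiAccretive (hω n)
  -- The exponential estimates need a nonnegative constant, and quasi-accretivity passes to larger
  -- constants.
  have hA' : ∀ n, NonlinOp.QuasiAccretive (max ω 0) (A n) := fun n =>
    (hacc n).quasiAccretive ((hω n).trans (le_max_left _ _))
  have hunif := fun (T : ℝ) (hT : 0 ≤ T) => NonlinOp.tendstoUniformlyOn_semigroup hξ
    (le_max_right ω 0) hA' hrange hconv hz hzconv hT
  exact ⟨fun c hc => ⟨fun n => (hA n).resolvent_subsingleton hc (z n),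
      NonlinOp.tendsto_resolvent hξ hA hconv hzconv hc⟩,
    fun n => NonlinOp.mem_semigroupDomain (le_max_right ω 0) (hA' n) (hrange n) (hz n),
    fun t ht => (hunif t ht).tendsto_at ⟨ht, le_rfl⟩, hunif⟩
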